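/- A DFA over a finite alphabet $\Sigma$ has a finite set $Q$ of states, an initial state, a set of final states, and at most one transition for each state and each letter; $L(A)$ is the language accepted by $A$. For strings $x,y\in\Sigma^*$ let $$x \stackrel{\rm max\text{-}sdi}{\leftarrow} y=\{x_1uzvx_2 \mid x=x_1uvx_2,\ y=uzv,\ u\ne\varepsilon\ne v,\ \text{and there are no suffix } x_1' \text{ of } x_1 \text{ and prefix } x_2' \text{ of } x_2 \text{ with } x_1'x_2'\neq\varepsilon \text{ and } y\in x_1'u\Sigma^*vx_2'\},$$ $$x \stackrel{\rm min\text{-}sdi}{\leftarrow} y=\{x_1uzvx_2 \mid x=x_1uvx_2,\ y=uzv,\ u\ne\varepsilon\ne v,\ \text{no proper nonempty suffix of } u \text{ is a prefix of } u, \text{ and no proper nonempty prefix of } v \text{ is a suffix of } v\},$$ and for languages let $L_1\stackrel{\rm max\text{-}sdi}{\leftarrow}L_2$ and $L_1\stackrel{\rm min\text{-}sdi}{\leftarrow}L_2$ be the unions of the corresponding sets over all $x\in L_1$ and $y\in L_2$. **Lemma.** There is an algorithm that, given a finite alphabet $\Sigma$, DFAs $A$ and $B$ over $\Sigma$ (as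 transition tables) and a string $w\in\Sigma^*$, decides in time $O(n^6)$ whether $w\in L(A)\stackrel{\rm max\text{-}sdi}{\leftarrow}L(B)$, and there is another that decides in time $O(n^6)$ whether $w\in L(A)\stackrel{\rm min\text{-}sdi}{\leftarrow}L(B)$. Here $n=|w|+|Q_A|+|Q_B|$ is the length of $w$ plus the numbers of states of $A$ and $B$, the constant in $O(n^6)$ is absolute (in particular it does not depend on $\Sigma$), and time is the number of steps of a random access machine with unit cost, whose arithmetic instructions are addition and truncated subtraction, and which starts with the input in its memory. -/

import Mathlib

namespace SDI

/-! ### Maximal and minimal site-directed insertion -/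

section Operations

variable {α : Type*}

/-- The maximal site-directed insertion of the string `y` into the string `x`. -/
def wordMaxSDI (x y : List α) : Set (List α) :=
  {t | ∃ x₁ u z v x₂ : List α,
    t = x₁ ++ u ++ z ++ v ++ x₂ ∧ x = x₁ ++ u ++ v ++ x₂ ∧ y = u ++ z ++ v ∧ u ≠ [] ∧ v ≠ [] ∧
    ¬ ∃ x₁' x₂' : List α, x₁' <:+ x₁ ∧ x₂' <+: x₂ ∧ x₁' ++ x₂' ≠ [] ∧
        ∃ z' : List α, y = x₁' ++ u ++ z' ++ v ++ x₂'}

/-- The minimal site-directed insertion of the string `y` into the string `x`. -/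
def wordMinSDI (x y : List α) : Set (List α) :=
  {t | ∃ x₁ u z v x₂ : List α,
    t = x₁ ++ u ++ z ++ v ++ x₂ ∧ x = x₁ ++ u ++ v ++ x₂ ∧ y = u ++ z ++ v ∧ u ≠ [] ∧ v ≠ [] ∧
    (¬ ∃ p : List α, p <:+ u ∧ p ≠ u ∧ p ≠ [] ∧ p <+: u) ∧
    (¬ ∃ p : List α, p <+: v ∧ p ≠ v ∧ p ≠ [] ∧ p <:+ v)}

/-- The maximal site-directed insertion of the language `L₂` into the language `L₁`. -/
def maxSDI (L₁ L₂ : Language α) : Language α :=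
  {t | ∃ x ∈ L₁, ∃ y ∈ L₂, t ∈ wordMaxSDI x y}

/-- The minimal site-directed insertion of the language `L₂` into the language `L₁`. -/
def minSDI (L₁ L₂ : Language α) : Language α :=
  {t | ∃ x ∈ L₁, ∃ y ∈ L₂, t ∈ wordMinSDI x y}

end Operations

/-! ### Deterministic finite automata (the transition function may be partial) -/

/-- A deterministic finite automaton with input alphabet `{0, …, s - 1}` and states
`{0, …, k - 1}`: every state has at most one transition for each letter. -/
structure PDFA (s k : ℕ) where
  /-- the transition function; the value `none` means that there is no transition -/
  step : Fin k → Fin s → Option (Fin k)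
  /-- the initial state -/
  start : Fin k
  /-- the final states -/
  accept : Fin k → Bool

namespace PDFA

variable {s k : ℕ}

/-- The state reached from `q` by reading `w`, if the computation does not get stuck. -/
def run (M : PDFA s k) : Fin k → List (Fin s) → Option (Fin k)
  | q, [] => some q
  | q, a :: w =>
    match M.step q a with
    | none => none
    | some q' => M.run q' w

/-- The language accepted by the automaton. -/
def language (M : PDFA s k) : Language (Fin s) :=
  {w | ∃ q, M.run M.start w = some q ∧ M.accept q = true}

/-- The entry of the transition table for one state and one letter: `0` if there is no
transition and `q + 1` if there is a transition to the state `q`. -/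
def entry (M : PDFA s k) (q : Fin k) (a : Fin s) : ℕ :=
  match M.step q a with
  | none => 0
  | some q' => (q' : ℕ) + 1

/-- The description of an automaton: the `k` flags of the final states, followed by the `k` rows
of the transition table, each of length `s`. -/
def encode (M : PDFA s k) : List ℕ :=
  (List.finRange k).map (fun q => if M.accept q then 1 else 0) ++
    (List.finRange k).flatMap (fun q => (List.finRange s).map (fun a => M.entry q a))

end PDFA

/-- The input of the membership problem, as a sequence of natural numbers: six numbers for the
size of the alphabet, the numbers of states, the length of the string and the initial states, then
the string and the descriptions of the two automata. -/
def encodeInput {s kA kB : ℕ} (A : PDFA s kA) (B : PDFA s kB) (w : List (Fin s)) : List ℕ :=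
  [s, kA, kB, w.length, (A.start : ℕ), (B.start : ℕ)] ++ w.map (fun a => (a : ℕ)) ++
    A.encode ++ B.encode

/-! ### Random access machines with unit cost -/

namespace RAM

/-- A configuration of the machine: registers and memory cells, all holding natural numbers.
(A program mentions finitely many registers; the memory is accessed indirectly.) -/
structure State where
  /-- the registers -/
  reg : ℕ → ℕ
  /-- the memory -/
  mem : ℕ → ℕ

/-- Programs of the random access machine. The arguments of the instructions are numbers of
registers, except the constant `c`. There is no multiplication. -/
inductive Prog : Type
  /-- do nothing -/
  | skip : Prog
  /-- `reg r := c` -/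
  | const (r c : ℕ) : Prog
  /-- `reg r := reg a + reg b` -/
  | add (r a b : ℕ) : Prog
  /-- `reg r := max (reg a - reg b) 0` -/
  | sub (r a b : ℕ) : Prog
  /-- `reg r := mem (reg a)` -/
  | load (r a : ℕ) : Prog
  /-- `mem (reg a) := reg r` -/
  | store (a r : ℕ) : Prog
  /-- first `P`, then `Q` -/
  | seq (P Q : Prog) : Prog
  /-- `P` if `reg r ≠ 0`, otherwise `Q` -/
  | ite (r : ℕ) (P Q : Prog) : Prog
  /-- repeat `P` while `reg r ≠ 0` -/
  | loop (r : ℕ) (P : Prog) : Prog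

/-- Assignment of a value to a register. -/
def State.setReg (σ : State) (r x : ℕ) : State :=
  { σ with reg := Function.update σ.reg r x }

/-- Assignment of a value to a memory cell. -/
def State.setMem (σ : State) (i x : ℕ) : State :=
  { σ with mem := Function.update σ.mem i x }

/-- `Exec P σ t τ`: the program `P`, started in `σ`, halts in `τ` after exactly `t` steps, where
every elementary instruction and every test of a register takes one step. -/
inductive Exec : Prog → State → ℕ → State → Prop
  | skip (σ : State) : Exec .skip σ 1 σ
  | const (r c : ℕ) (σ : State) : Exec (.const r c) σ 1 (σ.setReg r c)
  | add (r a b : ℕ) (σ : State) : Exec (.add r a b) σ 1 (σ.setReg r (σ.reg a + σ.reg b))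
  | sub (r a b : ℕ) (σ : State) : Exec (.sub r a b) σ 1 (σ.setReg r (σ.reg a - σ.reg b))
  | load (r a : ℕ) (σ : State) : Exec (.load r a) σ 1 (σ.setReg r (σ.mem (σ.reg a)))
  | store (a r : ℕ) (σ : State) : Exec (.store a r) σ 1 (σ.setMem (σ.reg a) (σ.reg r))
  | seq {P Q : Prog} {σ τ υ : State} {t t' : ℕ} :
      Exec P σ t τ → Exec Q τ t' υ → Exec (.seq P Q) σ (t + t') υ
  | ite_true {r : ℕ} {P Q : Prog} {σ τ : State} {t : ℕ} :
      σ.reg r ≠ 0 → Exec P σ t τ → Exec (.ite r P Q) σ (t + 1) τ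
  | ite_false {r : ℕ} {P Q : Prog} {σ τ : State} {t : ℕ} :
      σ.reg r = 0 → Exec Q σ t τ → Exec (.ite r P Q) σ (t + 1) τ
  | loop_stop {r : ℕ} {P : Prog} {σ : State} :
      σ.reg r = 0 → Exec (.loop r P) σ 1 σ
  | loop_step {r : ℕ} {P : Prog} {σ τ υ : State} {t t' : ℕ} :
      σ.reg r ≠ 0 → Exec P σ t τ → Exec (.loop r P) τ t' υ →
      Exec (.loop r P) σ (t + t' + 1) υ

/-- The initial configuration: the input stands at the beginning of the memory, and all other
memory cells and all registers hold `0`. -/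
def initial (input : List ℕ) : State where
  reg := fun _ => 0
  mem := fun i => input.getD i 0

/-- On the given input the program halts after at most `T` steps, and register `0` then holds `1`
if `p` is true and `0` if `p` is false. -/
def Prog.DecidesWithin (P : Prog) (input : List ℕ) (p : Prop) (T : ℕ) : Prop :=
  ∃ (t : ℕ) (τ : State), Exec P (initial input) t τ ∧ t ≤ T ∧
    (p → τ.reg 0 = 1) ∧ (¬ p → τ.reg 0 = 0)

end RAM

end SDI

/-! A word `w` lies in either insertion exactly when it can be cut at positions `i < j ≤ k < l` into
`x₁`, `u`, `z`, `v`, `x₂` so that `A` accepts `w` without the block `z`, `B` accepts the block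
between `i` and `l`, and a side condition holds. Both side conditions say that certain pairs of
equally long factors of `w`, shifted by some `d`, differ. For maximality, an extension of the match,
if any exists, can be taken on one side only (`exists_extension_iff`); for minimality, a border is a
self-overlap (`exists_border_iff`). The results are `mem_maxSDI_iff` and `mem_minSDI_iff`.

Exhaustive search then suffices: there are `O(n^4)` quadruples, each tested in `O(n^2)`. For the
side condition there are `O(n)` shifts `d`, each with a linear comparison. For the automata there
are `O(n)` letters, each with one table lookup; its row offset, state times alphabet size, is found
by adding the alphabet size as many times as the state number says, so it costs `O(n)` whatever the
alphabet.

The search is written as an `Expr` with a value and an exact step count, and `compile_spec`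
transfers both to the machine. Correctness (`eval_search`) and running time (`cost_search_le`) are
thus proved about expressions only. -/

namespace SDI

namespace RAM

/-! ### A small expression language and its compilation -/

/-- `iter n f a` is the result of the loop `for i < n do acc := f i acc` started with
`acc = a`. -/
def iter : ℕ → (ℕ → ℕ → ℕ) → ℕ → ℕ
  | 0, _, a => a
  | n + 1, f, a => f n (iter n f a)

/-- Expressions over an environment of natural numbers (variables are de Bruijn indices) and a
memory that is only read. -/
inductive Expr : Type
  | const (c : ℕ) : Expr
  | var (i : ℕ) : Expr
  | add (a b : Expr) : Expr
  | sub (a b : Expr) : Expr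
  | load (a : Expr) : Expr
  /-- `a` if `c ≠ 0`, otherwise `b` -/
  | ite (c a b : Expr) : Expr
  /-- the body `b` with variable `0` bound to `a` -/
  | bind (a b : Expr) : Expr
  /-- `n`-fold iteration of the body `b`, in which variable `0` is the accumulator and variable
  `1` the index -/
  | fold (n a b : Expr) : Expr

namespace Expr

/-- The value of an expression. -/
def eval (m : ℕ → ℕ) : Expr → List ℕ → ℕ
  | const c, _ => c
  | var i, l => l.getD i 0
  | add a b, l => a.eval m l + b.eval m l
  | sub a b, l => a.eval m l - b.eval m l
  | load a, l => m (a.eval m l)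
  | ite c a b, l => if c.eval m l ≠ 0 then a.eval m l else b.eval m l
  | bind a b, l => b.eval m (a.eval m l :: l)
  | fold n a b, l =>
    iter (n.eval m l) (fun i acc => b.eval m (acc :: i :: l)) (a.eval m l)

/-- The number of steps of the compiled expression. -/
def cost (m : ℕ → ℕ) : Expr → List ℕ → ℕ
  | const _, _ => 1
  | var i, l => if i < l.length then 2 else 1
  | add a b, l => a.cost m l + (b.cost m l + 1)
  | sub a b, l => a.cost m l + (b.cost m l + 1)
  | load a, l => a.cost m l + 1
  | ite c a b, l => c.cost m l + ((if c.eval m l ≠ 0 then a.cost m l else b.cost m l) + 1)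
  | bind a b, l => a.cost m l + (b.cost m (a.eval m l :: l) + 2)
  | fold n a b, l =>
    n.cost m l + (a.cost m l + (1 + (1 + ((∑ i ∈ Finset.range (n.eval m l),
      (b.cost m (iter i (fun i acc => b.eval m (acc :: i :: l)) (a.eval m l) :: i :: l) + 6)) + 1
      + 2))))

/-- Copying the register `b` to the register `a`, using the register `b + 1`. -/
def move (a b : ℕ) : Prog := .seq (.const (b + 1) 0) (.add a b (b + 1))

/-- The program that puts the value of an expression into the register `r` without changing the
registers below `r`; the variables stand in the registers listed in the second argument. -/
def compile : Expr → List ℕ → ℕ → Prog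
  | const c, _, r => .const r c
  | var i, l, r =>
    match l[i]? with
    | none => .const r 0
    | some x => .seq (.const r 0) (.add r x r)
  | add a b, l, r => .seq (a.compile l r) (.seq (b.compile l (r + 1)) (.add r r (r + 1)))
  | sub a b, l, r => .seq (a.compile l r) (.seq (b.compile l (r + 1)) (.sub r r (r + 1)))
  | load a, l, r => .seq (a.compile l r) (.load r r)
  | ite c a b, l, r => .seq (c.compile l r) (.ite r (a.compile l r) (b.compile l r))
  | bind a b, l, r => .seq (a.compile l r) (.seq (b.compile (r :: l) (r + 1)) (move r (r + 1)))
  | fold n a b, l, r =>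
    -- Layout: `r` holds the bound, `r + 1` the index, `r + 2` the accumulator. Register `r + 3`
    -- receives the result of the body and is then reset to bound minus index, the loop test.
    .seq (n.compile l r) (.seq (a.compile l (r + 2)) (.seq (.const (r + 1) 0)
      (.seq (.sub (r + 3) r (r + 1)) (.seq
        (.loop (r + 3) (.seq (b.compile ((r + 2) :: (r + 1) :: l) (r + 3)) (.seq (move (r + 2) (r + 3))
          (.seq (.const (r + 3) 1) (.seq (.add (r + 1) (r + 1) (r + 3))
            (.sub (r + 3) r (r + 1)))))))
        (move r (r + 2))))))

theorem exec_move (a b : ℕ) (σ : State) :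
    ∃ τ, Exec (move a b) σ 2 τ ∧ τ.mem = σ.mem ∧ τ.reg a = σ.reg b ∧
      ∀ i, i ≠ a → i ≠ b + 1 → τ.reg i = σ.reg i := by
  refine ⟨_, .seq (.const _ _ _) (.add _ _ _ _), rfl, ?_, ?_⟩
  · simp [State.setReg]
  · intro i h1 h2
    simp [State.setReg, Function.update_of_ne, h1, h2]

/-- The specification of a program that computes `x` into the register `r` in `t` steps. -/
def Computes (P : Prog) (σ : State) (r t x : ℕ) : Prop :=
  ∃ τ, Exec P σ t τ ∧ τ.mem = σ.mem ∧ τ.reg r = x ∧ ∀ i < r, τ.reg i = σ.reg i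

theorem map_reg_congr {l : List ℕ} {r : ℕ} {σ τ : State} (hl : ∀ x ∈ l, x < r)
    (h : ∀ i < r, τ.reg i = σ.reg i) : l.map τ.reg = l.map σ.reg :=
  List.map_congr_left fun x hx => h x (hl x hx)

/-- The loop of a compiled `fold`. -/
theorem exec_loop {b : Expr} {l : List ℕ} {r : ℕ} (hl : ∀ x ∈ l, x < r)
    (hb : ∀ σ : State, Computes (b.compile ((r + 2) :: (r + 1) :: l) (r + 3)) σ (r + 3)
      (b.cost σ.mem (((r + 2) :: (r + 1) :: l).map σ.reg))
      (b.eval σ.mem (((r + 2) :: (r + 1) :: l).map σ.reg)))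
    (m : ℕ → ℕ) (env : List ℕ) (n a : ℕ) (k : ℕ) :
    ∀ (j : ℕ) (σ : State), j + k = n → σ.mem = m → l.map σ.reg = env → σ.reg r = n →
      σ.reg (r + 1) = j → σ.reg (r + 2) = iter j (fun i acc => b.eval m (acc :: i :: env)) a →
      σ.reg (r + 3) = k →
      ∃ τ, Exec (.loop (r + 3) (.seq (b.compile ((r + 2) :: (r + 1) :: l) (r + 3))
          (.seq (move (r + 2) (r + 3)) (.seq (.const (r + 3) 1)
            (.seq (.add (r + 1) (r + 1) (r + 3)) (.sub (r + 3) r (r + 1))))))) σ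
          (∑ i ∈ Finset.Ico j n,
            (b.cost m (iter i (fun i acc => b.eval m (acc :: i :: env)) a :: i :: env) + 6) + 1) τ ∧
        τ.mem = m ∧ τ.reg (r + 2) = iter n (fun i acc => b.eval m (acc :: i :: env)) a ∧
        ∀ i < r, τ.reg i = σ.reg i := by
  -- `k` is the number of remaining rounds, which is also the content of `r + 3`.
  induction k with
  | zero =>
    intro j σ hj hm he hn h1 h2 h3
    obtain rfl : j = n := by omega
    refine ⟨σ, ?_, hm, h2, fun _ _ => rfl⟩
    simpa using Exec.loop_stop h3
  | succ k ih =>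
    intro j σ hj hm he hn h1 h2 h3
    obtain ⟨τ₁, e₁, m₁, x₁, p₁⟩ := hb σ
    obtain ⟨τ₂, e₂, m₂, x₂, p₂⟩ := exec_move (r + 2) (r + 3) τ₁
    have q : ∀ i < r + 2, τ₂.reg i = σ.reg i := fun i hi => by
      rw [p₂ i (by omega) (by omega), p₁ i (by omega)]
    have e₃ := Exec.const (r + 3) 1 τ₂
    set τ₃ := τ₂.setReg (r + 3) 1 with hτ₃
    have e₄ := Exec.add (r + 1) (r + 1) (r + 3) τ₃
    set τ₄ := τ₃.setReg (r + 1) (τ₃.reg (r + 1) + τ₃.reg (r + 3)) with hτ₄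
    have e₅ := Exec.sub (r + 3) r (r + 1) τ₄
    set τ₅ := τ₄.setReg (r + 3) (τ₄.reg r - τ₄.reg (r + 1)) with hτ₅
    have q₅ : ∀ i < r, τ₅.reg i = σ.reg i := fun i hi => by
      simp [hτ₅, hτ₄, hτ₃, State.setReg, q i (by omega),
        show i ≠ r + 1 by omega, show i ≠ r + 3 by omega]
    have r₀ : τ₅.reg r = n := by
      have := q r (by omega)
      simp [hτ₅, hτ₄, hτ₃, State.setReg, this, hn]
    have r₁ : τ₅.reg (r + 1) = j + 1 := by
      have := q (r + 1) (by omega)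
      simp [hτ₅, hτ₄, hτ₃, State.setReg, this, h1]
    have r₂ : τ₅.reg (r + 2) = iter (j + 1) (fun i acc => b.eval m (acc :: i :: env)) a := by
      simp [hτ₅, hτ₄, hτ₃, State.setReg, x₂, x₁, iter, h1, h2, hm, he]
    have r₃ : τ₅.reg (r + 3) = k := by
      simp [hτ₅, hτ₄, hτ₃, State.setReg, q r (by omega), q (r + 1) (by omega), hn, h1]
      omega
    have hm₅ : τ₅.mem = m := by
      rw [← hm, ← m₁, ← m₂]; rfl
    obtain ⟨υ, e, mυ, xυ, pυ⟩ := ih (j + 1) τ₅ (by omega) hm₅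
      ((map_reg_congr hl q₅).trans he) r₀ r₁ r₂ r₃
    refine ⟨υ, ?_, mυ, xυ, fun i hi => (pυ i hi).trans (q₅ i hi)⟩
    have := Exec.loop_step (by omega)
      (e₁.seq (e₂.seq (e₃.seq (e₄.seq e₅)))) e
    convert this using 1
    -- Each round costs 6 steps beyond the body: 2 for the move, 3 for updating index and test
    -- register, 1 for the test.
    rw [Finset.sum_eq_sum_Ico_succ_bot (by omega)]
    simp only [List.map_cons, hm, he, h1, h2]
    ring

/-- Structural induction. Variables live below `r` and a program with target `r` preserves
everything below `r`, so the environment and the operands already computed survive while later ones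
are evaluated in higher registers. -/
theorem compile_spec (e : Expr) : ∀ (l : List ℕ) (r : ℕ) (σ : State), (∀ x ∈ l, x < r) →
    Computes (e.compile l r) σ r (e.cost σ.mem (l.map σ.reg)) (e.eval σ.mem (l.map σ.reg)) := by
  induction e with
  | const c =>
    intro l r σ hl
    refine ⟨_, .const _ _ _, rfl, by simp [State.setReg, eval], fun i hi => ?_⟩
    simp [State.setReg, hi.ne]
  | var i =>
    intro l r σ hl
    by_cases h : i < l.length
    · have hx := hl l[i] (by simp)
      simp only [Computes, compile, List.getElem?_eq_getElem h, cost, List.length_map, h, if_true]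
      refine ⟨_, .seq (.const _ _ _) (.add _ _ _ _), rfl, ?_, fun j hj => ?_⟩
      · simp [State.setReg, eval, h, hx.ne]
      · simp [State.setReg, hj.ne]
    · simp only [Computes, compile, List.getElem?_eq_none (not_lt.1 h), cost, List.length_map, h,
        if_false]
      refine ⟨_, .const _ _ _, rfl, ?_, fun j hj => ?_⟩
      · simp [State.setReg, eval, h]
      · simp [State.setReg, hj.ne]
  | add a b iha ihb =>
    intro l r σ hl
    obtain ⟨τ₁, e₁, m₁, x₁, p₁⟩ := iha l r σ hl
    obtain ⟨τ₂, e₂, m₂, x₂, p₂⟩ := ihb l (r + 1) τ₁ fun x hx => (hl x hx).trans (by omega)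
    rw [m₁, map_reg_congr hl p₁] at e₂ x₂
    refine ⟨_, e₁.seq (e₂.seq (.add _ _ _ _)), m₂.trans m₁, ?_, ?_⟩
    · simp [State.setReg, x₂, p₂ r, x₁, eval]
    · intro j hj
      simp [State.setReg, hj.ne, p₂ j (by omega), p₁ j hj]
  | sub a b iha ihb =>
    intro l r σ hl
    obtain ⟨τ₁, e₁, m₁, x₁, p₁⟩ := iha l r σ hl
    obtain ⟨τ₂, e₂, m₂, x₂, p₂⟩ := ihb l (r + 1) τ₁ fun x hx => (hl x hx).trans (by omega)
    rw [m₁, map_reg_congr hl p₁] at e₂ x₂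
    refine ⟨_, e₁.seq (e₂.seq (.sub _ _ _ _)), m₂.trans m₁, ?_, ?_⟩
    · simp [State.setReg, x₂, p₂ r, x₁, eval]
    · intro j hj
      simp [State.setReg, hj.ne, p₂ j (by omega), p₁ j hj]
  | load a iha =>
    intro l r σ hl
    obtain ⟨τ₁, e₁, m₁, x₁, p₁⟩ := iha l r σ hl
    refine ⟨_, e₁.seq (.load _ _ _), m₁, ?_, ?_⟩
    · simp [State.setReg, x₁, m₁, eval]
    · intro j hj
      simp [State.setReg, hj.ne, p₁ j hj]
  | ite c a b ihc iha ihb =>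
    intro l r σ hl
    obtain ⟨τ₁, e₁, m₁, x₁, p₁⟩ := ihc l r σ hl
    by_cases h : c.eval σ.mem (l.map σ.reg) = 0
    · obtain ⟨τ₂, e₂, m₂, x₂, p₂⟩ := ihb l r τ₁ hl
      rw [m₁, map_reg_congr hl p₁] at e₂ x₂
      refine ⟨τ₂, ?_, m₂.trans m₁, ?_, fun j hj => (p₂ j hj).trans (p₁ j hj)⟩
      · rw [compile, cost, if_neg (not_not.2 h)]
        exact e₁.seq (.ite_false (x₁.trans h) e₂)
      · simpa [eval, h] using x₂
    · obtain ⟨τ₂, e₂, m₂, x₂, p₂⟩ := iha l r τ₁ hl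
      rw [m₁, map_reg_congr hl p₁] at e₂ x₂
      refine ⟨τ₂, ?_, m₂.trans m₁, ?_, fun j hj => (p₂ j hj).trans (p₁ j hj)⟩
      · rw [compile, cost, if_pos h]
        exact e₁.seq (.ite_true (x₁.trans_ne h) e₂)
      · simpa [eval, h] using x₂
  | bind a b iha ihb =>
    intro l r σ hl
    obtain ⟨τ₁, e₁, m₁, x₁, p₁⟩ := iha l r σ hl
    obtain ⟨τ₂, e₂, m₂, x₂, p₂⟩ := ihb (r :: l) (r + 1) τ₁ (by
      simpa using fun x hx => Nat.lt_succ_of_lt (hl x hx))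
    rw [m₁, List.map_cons, x₁, map_reg_congr hl p₁] at e₂ x₂
    obtain ⟨τ₃, e₃, m₃, x₃, p₃⟩ := exec_move r (r + 1) τ₂
    refine ⟨τ₃, e₁.seq (e₂.seq e₃), m₃.trans (m₂.trans m₁), x₃.trans x₂, fun j hj => ?_⟩
    rw [p₃ j (by omega) (by omega), p₂ j (by omega), p₁ j hj]
  | fold n a b ihn iha ihb =>
    intro l r σ hl
    obtain ⟨τ₁, e₁, m₁, x₁, p₁⟩ := ihn l r σ hl
    obtain ⟨τ₂, e₂, m₂, x₂, p₂⟩ := iha l (r + 2) τ₁ fun x hx => (hl x hx).trans (by omega)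
    rw [m₁, map_reg_congr hl p₁] at e₂ x₂
    have e₃ := Exec.const (r + 1) 0 τ₂
    set τ₃ := τ₂.setReg (r + 1) 0 with hτ₃
    have e₄ := Exec.sub (r + 3) r (r + 1) τ₃
    set τ₄ := τ₃.setReg (r + 3) (τ₃.reg r - τ₃.reg (r + 1)) with hτ₄
    have q : ∀ i < r, τ₄.reg i = σ.reg i := fun i hi => by
      simp [hτ₄, hτ₃, State.setReg, p₂ i (by omega), p₁ i hi,
        show i ≠ r + 1 by omega, show i ≠ r + 3 by omega]
    obtain ⟨τ₅, e₅, m₅, x₅, p₅⟩ := exec_loop (b := b) hl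
      (fun σ => ihb _ _ σ (by
        simp only [List.mem_cons, forall_eq_or_imp]
        exact ⟨by omega, by omega, fun x hx => (hl x hx).trans (by omega)⟩))
      σ.mem (l.map σ.reg) (n.eval σ.mem (l.map σ.reg)) (a.eval σ.mem (l.map σ.reg))
      (n.eval σ.mem (l.map σ.reg)) 0 τ₄ (by omega) (m₂.trans m₁) (map_reg_congr hl q)
      (by simp [hτ₄, hτ₃, State.setReg, p₂ r, x₁])
      (by simp [hτ₄, hτ₃, State.setReg])
      (by simp [hτ₄, hτ₃, State.setReg, x₂, iter])
      (by simp [hτ₄, hτ₃, State.setReg, p₂ r, x₁])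
    obtain ⟨τ₆, e₆, m₆, x₆, p₆⟩ := exec_move r (r + 2) τ₅
    refine ⟨τ₆, ?_, m₆.trans m₅, x₆.trans x₅, fun j hj => ?_⟩
    · have := e₁.seq (e₂.seq (e₃.seq (e₄.seq (e₅.seq e₆))))
      rwa [← Finset.range_eq_Ico] at this
    · rw [p₆ j (by omega) (by omega), p₅ j hj, q j hj]

/-- An expression with value `1` or `0` yields a decision procedure. -/
theorem decidesWithin_compile (e : Expr) (input : List ℕ) (p : Prop) (T : ℕ)
    (hT : e.cost (fun i => input.getD i 0) [] ≤ T)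
    (h₁ : p → e.eval (fun i => input.getD i 0) [] = 1)
    (h₀ : ¬ p → e.eval (fun i => input.getD i 0) [] = 0) :
    (e.compile [] 0).DecidesWithin input p T := by
  obtain ⟨τ, e, -, x, -⟩ := e.compile_spec [] 0 (initial input) (by simp)
  exact ⟨_, τ, e, hT, fun h => x.trans (h₁ h), fun h => x.trans (h₀ h)⟩

end Expr

end RAM

end SDI

namespace SDI

/-! ### Insertions in terms of positions in the resulting string -/

section Positions

variable {α : Type*}

/-- The factor of length `n` of `w` that starts at the position `p`. -/
def factor (w : List α) (p n : ℕ) : List α := (w.drop p).take n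

theorem factor_append (a b c : List α) (p n : ℕ) (hp : p = a.length) (hn : n = b.length) :
    factor (a ++ (b ++ c)) p n = b := by
  subst hp hn; simp [factor]

theorem length_factor {w : List α} {p n : ℕ} (h : p + n ≤ w.length) :
    (factor w p n).length = n := by
  simp [factor]; omega

theorem factor_add (w : List α) (p m n : ℕ) :
    factor w p (m + n) = factor w p m ++ factor w (p + m) n := by
  simp [factor, List.take_add, List.drop_drop]

/-- The string `x` has a proper nonempty border if and only if it overlaps with itself. -/
theorem exists_border_iff (x : List α) :
    (∃ p : List α, p <:+ x ∧ p ≠ x ∧ p ≠ [] ∧ p <+: x) ↔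
      ∃ d, 1 ≤ d ∧ d < x.length ∧ factor x 0 (x.length - d) = factor x d (x.length - d) := by
  constructor
  -- The shift is the length of what precedes the border; conversely, dropping `d` letters leaves
  -- the border.
  · rintro ⟨p, ⟨a, rfl⟩, hne, hnil, ⟨b, hb⟩⟩
    have ha : a ≠ [] := by rintro rfl; simp at hne
    refine ⟨a.length, List.length_pos_iff.2 ha, ?_, ?_⟩
    · simpa using List.length_pos_iff.2 hnil
    · rw [show factor (a ++ p) a.length _ = p by simp [factor], ← hb]
      have := congrArg List.length hb
      simp at this
      simp [factor, this]
  · rintro ⟨d, h1, h2, h⟩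
    have h3 : factor x d (x.length - d) = x.drop d := by
      simp [factor]
    refine ⟨x.drop d, List.drop_suffix _ _, fun hd => ?_, fun hd => ?_, ?_⟩
    · have := congrArg List.length hd; simp at this; omega
    · have := congrArg List.length hd; simp at this; omega
    · rw [← h3, ← h]; simpa [factor] using List.take_prefix _ _

theorem factor_factor {w : List α} {p n q m : ℕ} (h : q + m ≤ n) :
    factor (factor w p n) q m = factor w (p + q) m := by
  simp only [factor, List.drop_take, List.drop_drop, List.take_take]
  congr 1; omega

/-- If the matched parts can be extended at all, then they can be extended on one side only. -/
theorem exists_extension_iff (x₁ u z v x₂ : List α) :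
    (∃ x₁' x₂' : List α, x₁' <:+ x₁ ∧ x₂' <+: x₂ ∧ x₁' ++ x₂' ≠ [] ∧
        ∃ z' : List α, u ++ z ++ v = x₁' ++ u ++ z' ++ v ++ x₂') ↔
      (∃ x₁' z₁, x₁' ≠ [] ∧ x₁' <:+ x₁ ∧ z₁ <+: z ∧ x₁' ++ u = u ++ z₁) ∨
      (∃ x₂' z₂, x₂' ≠ [] ∧ x₂' <+: x₂ ∧ z₂ <:+ z ∧ v ++ x₂' = z₂ ++ v) := by
  constructor
  · rintro ⟨x₁', x₂', h₁, h₂, hne, z', h⟩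
    -- Lengths give `|z| = |x₁'| + |z'| + |x₂'|`, so either extension alone fits into `z`. If `x₁'`
    -- is nonempty it is a witness by itself and `x₂'` is discarded.
    have hl := congrArg List.length h
    simp only [List.length_append] at hl
    by_cases hx : x₁' = []
    · right
      subst hx
      refine ⟨x₂', z.drop (z.length - x₂'.length), by simpa using hne, h₂, List.drop_suffix _ _, ?_⟩
      have h' : (u ++ z.take (z.length - x₂'.length)) ++ (z.drop (z.length - x₂'.length) ++ v) =
          (u ++ z') ++ (v ++ x₂') := by
        rw [List.append_assoc, ← List.append_assoc (List.take _ _), List.take_append_drop]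
        simpa using h
      simp at hl
      refine ((List.append_inj' h' ?_).2).symm
      simp; omega
    · left
      refine ⟨x₁', z.take x₁'.length, hx, h₁, List.take_prefix _ _, ?_⟩
      have h' : (u ++ z.take x₁'.length) ++ (z.drop x₁'.length ++ v) =
          (x₁' ++ u) ++ (z' ++ v ++ x₂') := by
        rw [List.append_assoc, ← List.append_assoc (List.take _ _), List.take_append_drop]
        simpa using h
      refine ((List.append_inj h' ?_).1).symm
      simp; omega
  · rintro (⟨x₁', z₁, hne, h₁, ⟨z', rfl⟩, h⟩ | ⟨x₂', z₂, hne, h₂, ⟨z', rfl⟩, h⟩)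
    · exact ⟨x₁', [], h₁, by simp, by simpa using hne, z', by simp [h]⟩
    · exact ⟨[], x₂', by simp, h₂, by simpa using hne, z', by simp [h]⟩

/-- With `d = |x₁'|`, the word `x₁'u` ends where `u` ends and `uz₁` begins where `u` begins. They
are factors of the same length at distance `d`, and both lie inside `x₁uz`. -/
theorem exists_left_extension_iff (x₁ u z r : List α) :
    (∃ x₁' z₁, x₁' ≠ [] ∧ x₁' <:+ x₁ ∧ z₁ <+: z ∧ x₁' ++ u = u ++ z₁) ↔
      ∃ d, 1 ≤ d ∧ d ≤ x₁.length ∧ d ≤ z.length ∧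
        factor (x₁ ++ u ++ z ++ r) (x₁.length - d) (u.length + d) =
          factor (x₁ ++ u ++ z ++ r) x₁.length (u.length + d) := by
  constructor
  · rintro ⟨x₁', z₁, hne, ⟨y, rfl⟩, ⟨z', rfl⟩, h⟩
    have hl := congrArg List.length h
    simp only [List.length_append] at hl
    refine ⟨x₁'.length, List.length_pos_iff.2 hne, by simp, by simp; omega, ?_⟩
    have h1 := factor_append y (x₁' ++ u) (z₁ ++ z' ++ r) ((y ++ x₁').length - x₁'.length)
      (u.length + x₁'.length) (by simp) (by simp; omega)
    have h2 := factor_append (y ++ x₁') (u ++ z₁) (z' ++ r) ((y ++ x₁').length)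
      (u.length + x₁'.length) (by simp) (by simp; omega)
    simp only [List.append_assoc] at h1 h2 h ⊢
    rw [h1, h2, h]
  · rintro ⟨d, hd, h₁, h₂, h⟩
    refine ⟨x₁.drop (x₁.length - d), z.take d, ?_, List.drop_suffix _ _, List.take_prefix _ _, ?_⟩
    · intro h0; have := congrArg List.length h0; simp at this; omega
    · have h1 := factor_append (x₁.take (x₁.length - d)) (x₁.drop (x₁.length - d) ++ u) (z ++ r)
        (x₁.length - d) (u.length + d) (by simp) (by simp; omega)
      have h2 := factor_append x₁ (u ++ z.take d) (z.drop d ++ r) x₁.length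
        (u.length + d) (by simp) (by simp; omega)
      rw [← h1, ← h2]
      convert h using 2 <;> simp [← List.append_assoc]
      simp [List.append_assoc]

theorem exists_right_extension_iff (l z v x₂ : List α) :
    (∃ x₂' z₂, x₂' ≠ [] ∧ x₂' <+: x₂ ∧ z₂ <:+ z ∧ v ++ x₂' = z₂ ++ v) ↔
      ∃ d, 1 ≤ d ∧ d ≤ x₂.length ∧ d ≤ z.length ∧
        factor (l ++ z ++ v ++ x₂) ((l ++ z).length - d) (v.length + d) =
          factor (l ++ z ++ v ++ x₂) (l ++ z).length (v.length + d) := by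
  constructor
  · rintro ⟨x₂', z₂, hne, ⟨y, rfl⟩, ⟨z', rfl⟩, h⟩
    have hl := congrArg List.length h
    simp only [List.length_append] at hl
    refine ⟨x₂'.length, List.length_pos_iff.2 hne, by simp, by simp; omega, ?_⟩
    have h1 := factor_append (l ++ z') (z₂ ++ v) (x₂' ++ y) ((l ++ (z' ++ z₂)).length - x₂'.length)
      (v.length + x₂'.length) (by simp; omega) (by simp; omega)
    have h2 := factor_append (l ++ z' ++ z₂) (v ++ x₂') y ((l ++ (z' ++ z₂)).length)
      (v.length + x₂'.length) (by simp) (by simp)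
    simp only [List.append_assoc] at h1 h2 h ⊢
    rw [h1, h2, h]
  · rintro ⟨d, hd, h₁, h₂, h⟩
    refine ⟨x₂.take d, z.drop (z.length - d), ?_, List.take_prefix _ _, List.drop_suffix _ _, ?_⟩
    · intro h0
      have := congrArg List.length h0
      simp only [List.length_take, List.length_nil] at this
      omega
    · have h1 := factor_append (l ++ z.take (z.length - d)) (z.drop (z.length - d) ++ v) x₂
        ((l ++ z).length - d) (v.length + d) (by simp only [List.length_append, List.length_take]; omega) (by simp; omega)
      have h2 := factor_append (l ++ z) (v ++ x₂.take d) (x₂.drop d) (l ++ z).length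
        (v.length + d) (by simp) (by simp; omega)
      rw [← h1, ← h2]
      convert h.symm using 2
      · simp
      · rw [List.append_assoc l, ← List.append_assoc (List.take _ _), ← List.append_assoc (List.take _ _),
          List.take_append_drop]
        simp

/-- The factors of length `n` at the positions `p` and `p + d` agree. -/
def Overlap (w : List α) (p d n : ℕ) : Prop := factor w p n = factor w (p + d) n

/-- Four positions that cut `w` into `x₁`, `u`, `z`, `v` and `x₂`, so that the two strings
`x₁uvx₂` and `uzv` belong to the given languages. -/
def Cut (L₁ L₂ : Language α) (w : List α) (i j k l : ℕ) : Prop :=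
  i < j ∧ j ≤ k ∧ k < l ∧ l ≤ w.length ∧
    factor w 0 j ++ factor w k (w.length - k) ∈ L₁ ∧ factor w i (l - i) ∈ L₂

/-- Bookkeeping shared by both operations: a factorization into five blocks is determined by its
four inner boundaries, so only the side condition has to be translated separately. -/
theorem exists_cut_iff (L₁ L₂ : Language α) (w : List α)
    (p : List α → List α → List α → List α → List α → Prop) (q : ℕ → ℕ → ℕ → ℕ → Prop)
    (h : ∀ x₁ u z v x₂ : List α, w = x₁ ++ u ++ z ++ v ++ x₂ → (p x₁ u z v x₂ ↔
      q x₁.length (x₁ ++ u).length (x₁ ++ u ++ z).length (x₁ ++ u ++ z ++ v).length)) :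
    (∃ x ∈ L₁, ∃ y ∈ L₂, ∃ x₁ u z v x₂ : List α, w = x₁ ++ u ++ z ++ v ++ x₂ ∧
      x = x₁ ++ u ++ v ++ x₂ ∧ y = u ++ z ++ v ∧ u ≠ [] ∧ v ≠ [] ∧ p x₁ u z v x₂) ↔
    ∃ i j k l, Cut L₁ L₂ w i j k l ∧ q i j k l := by
  have key : ∀ x₁ u z v x₂ : List α, w = x₁ ++ u ++ z ++ v ++ x₂ →
      factor w 0 (x₁ ++ u).length ++ factor w (x₁ ++ u ++ z).length
        (w.length - (x₁ ++ u ++ z).length) = x₁ ++ u ++ v ++ x₂ ∧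
      factor w x₁.length ((x₁ ++ u ++ z ++ v).length - x₁.length) = u ++ z ++ v := by
    rintro x₁ u z v x₂ rfl
    have h1 := factor_append [] (x₁ ++ u) (z ++ v ++ x₂) 0 (x₁ ++ u).length rfl rfl
    have h2 := factor_append (x₁ ++ u ++ z) (v ++ x₂) [] (x₁ ++ u ++ z).length
      ((x₁ ++ u ++ z ++ v ++ x₂).length - (x₁ ++ u ++ z).length) rfl (by simp; omega)
    have h3 := factor_append x₁ (u ++ z ++ v) x₂ x₁.length
      ((x₁ ++ u ++ z ++ v).length - x₁.length) rfl (by simp)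
    simp only [List.append_assoc, List.nil_append, List.append_nil] at h1 h2 h3 ⊢
    rw [h1, h2, h3]
    simp
  constructor
  · rintro ⟨x, hx, y, hy, x₁, u, z, v, x₂, hw, rfl, rfl, hu, hv, hp⟩
    have hu := List.length_pos_iff.2 hu
    have hv := List.length_pos_iff.2 hv
    obtain ⟨k₁, k₂⟩ := key _ _ _ _ _ hw
    refine ⟨_, _, _, _, ⟨?_, ?_, ?_, ?_, ?_, ?_⟩, (h _ _ _ _ _ hw).1 hp⟩
    · simpa using hu
    · simp
    · simpa using hv
    · simp [hw]
    · rwa [k₁]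
    · rwa [k₂]
  · rintro ⟨i, j, k, l, ⟨hij, hjk, hkl, hl, hA, hB⟩, hq⟩
    have hw : w = factor w 0 i ++ factor w i (j - i) ++ factor w j (k - j) ++ factor w k (l - k) ++
        factor w l (w.length - l) := by
      rw [show factor w i (j - i) = factor w (0 + i) (j - i) by simp, ← factor_add,
        show factor w j (k - j) = factor w (0 + (i + (j - i))) (k - j) by congr 1; omega,
        ← factor_add,
        show factor w k (l - k) = factor w (0 + (i + (j - i) + (k - j))) (l - k) by congr 1; omega,
        ← factor_add,
        show factor w l (w.length - l) =
          factor w (0 + (i + (j - i) + (k - j) + (l - k))) (w.length - l) by congr 1; omega,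
        ← factor_add]
      rw [factor, List.drop_zero, List.take_of_length_le (by omega)]
    have l₁ : (factor w 0 i).length = i := length_factor (by omega)
    have l₂ : (factor w i (j - i)).length = j - i := length_factor (by omega)
    have l₃ : (factor w j (k - j)).length = k - j := length_factor (by omega)
    have l₄ : (factor w k (l - k)).length = l - k := length_factor (by omega)
    obtain ⟨k₁, k₂⟩ := key _ _ _ _ _ hw
    have hh := h _ _ _ _ _ hw
    simp only [List.length_append, l₁, l₂, l₃, l₄] at k₁ k₂ hh
    rw [show i + (j - i) = j by omega, show j + (k - j) = k by omega] at k₁ k₂ hh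
    rw [show k + (l - k) = l by omega] at k₂ hh
    refine ⟨_, hA, _, hB, _, _, _, _, _, hw, k₁, k₂, ?_, ?_, hh.2 hq⟩
    · rw [← List.length_pos_iff]; omega
    · rw [← List.length_pos_iff]; omega

/-- Since one-sided extensions suffice, maximality splits into two independent tests. The length `d`
of an extension is limited by the room in `x₁` or `x₂` and by the room in `z`. -/
theorem mem_maxSDI_iff (L₁ L₂ : Language α) (w : List α) :
    w ∈ maxSDI L₁ L₂ ↔ ∃ i j k l, Cut L₁ L₂ w i j k l ∧
      (¬ ∃ d, 1 ≤ d ∧ d ≤ i ∧ d ≤ k - j ∧ Overlap w (i - d) d (j - i + d)) ∧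
      (¬ ∃ d, 1 ≤ d ∧ d ≤ w.length - l ∧ d ≤ k - j ∧ Overlap w (k - d) d (l - k + d)) := by
  have key := exists_cut_iff L₁ L₂ w
    (fun x₁ u z v x₂ => ¬ ∃ x₁' x₂' : List α, x₁' <:+ x₁ ∧ x₂' <+: x₂ ∧ x₁' ++ x₂' ≠ [] ∧
        ∃ z' : List α, u ++ z ++ v = x₁' ++ u ++ z' ++ v ++ x₂')
    (fun i j k l => (¬ ∃ d, 1 ≤ d ∧ d ≤ i ∧ d ≤ k - j ∧ Overlap w (i - d) d (j - i + d)) ∧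
      (¬ ∃ d, 1 ≤ d ∧ d ≤ w.length - l ∧ d ≤ k - j ∧ Overlap w (k - d) d (l - k + d))) ?_
  · rw [← key]
    constructor
    · rintro ⟨x, hx, y, hy, x₁, u, z, v, x₂, hw, rfl, rfl, h⟩
      exact ⟨_, hx, _, hy, x₁, u, z, v, x₂, hw, rfl, rfl, h⟩
    · rintro ⟨x, hx, y, hy, x₁, u, z, v, x₂, hw, rfl, rfl, h⟩
      exact ⟨_, hx, _, hy, x₁, u, z, v, x₂, hw, rfl, rfl, h⟩
  · rintro x₁ u z v x₂ rfl
    have hz : (x₁ ++ u ++ z).length - (x₁ ++ u).length = z.length := by simp; omega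
    have hu : (x₁ ++ u).length - x₁.length = u.length := by simp
    have hv : (x₁ ++ u ++ z ++ v).length - (x₁ ++ u ++ z).length = v.length := by simp; omega
    have hx : (x₁ ++ u ++ z ++ v ++ x₂).length - (x₁ ++ u ++ z ++ v).length = x₂.length := by simp; omega
    rw [exists_extension_iff, exists_left_extension_iff x₁ u z (v ++ x₂),
      exists_right_extension_iff (x₁ ++ u) z v x₂, not_or, hz, hu, hv, hx]
    refine and_congr (not_congr (exists_congr fun d => and_congr_right fun _ =>
      and_congr_right fun h₁ => and_congr_right fun _ => ?_))
      (not_congr (exists_congr fun d => and_congr_right fun _ =>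
      and_congr_right fun _ => and_congr_right fun h₁ => ?_))
    · rw [Overlap, Nat.sub_add_cancel h₁, ← List.append_assoc]
    · rw [Overlap, Nat.sub_add_cancel (by simp; omega)]

theorem mem_minSDI_iff (L₁ L₂ : Language α) (w : List α) :
    w ∈ minSDI L₁ L₂ ↔ ∃ i j k l, Cut L₁ L₂ w i j k l ∧
      (¬ ∃ d, 1 ≤ d ∧ d < j - i ∧ Overlap w i d (j - i - d)) ∧
      (¬ ∃ d, 1 ≤ d ∧ d < l - k ∧ Overlap w k d (l - k - d)) := by
  have key : ∀ a x b : List α, (∃ p : List α, p <:+ x ∧ p ≠ x ∧ p ≠ [] ∧ p <+: x) ↔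
      ∃ d, 1 ≤ d ∧ d < (a ++ x).length - a.length ∧
        Overlap (a ++ (x ++ b)) a.length d ((a ++ x).length - a.length - d) := by
    intro a x b
    rw [exists_border_iff]
    have hl : (a ++ x).length - a.length = x.length := by simp
    rw [hl]
    refine exists_congr fun d => and_congr_right fun _ => and_congr_right fun h => ?_
    have hx := factor_append a x b a.length x.length rfl rfl
    have h₁ := factor_factor (w := a ++ (x ++ b)) (p := a.length) (n := x.length) (q := 0)
      (m := x.length - d) (by omega)
    have h₂ := factor_factor (w := a ++ (x ++ b)) (p := a.length) (n := x.length) (q := d)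
      (m := x.length - d) (by omega)
    rw [hx] at h₁ h₂
    rw [h₁, h₂, Overlap, Nat.add_zero]
  refine exists_cut_iff L₁ L₂ w
    (fun x₁ u z v x₂ => (¬ ∃ p : List α, p <:+ u ∧ p ≠ u ∧ p ≠ [] ∧ p <+: u) ∧
      (¬ ∃ p : List α, p <+: v ∧ p ≠ v ∧ p ≠ [] ∧ p <:+ v)) _ ?_
  rintro x₁ u z v x₂ rfl
  refine and_congr (not_congr ?_) (not_congr ?_)
  · simpa [-List.length_append] using key x₁ u (z ++ v ++ x₂)
  · have := key (x₁ ++ u ++ z) v x₂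
    rw [← List.append_assoc] at this
    rw [← this]
    -- For `v` the roles of prefix and suffix are exchanged, which does not change the notion of
    -- border.
    exact exists_congr fun p => by tauto

end Positions

end SDI

namespace SDI

namespace RAM

namespace Expr

variable {m : ℕ → ℕ} {l : List ℕ}

/-! ### Derived constructs -/

/-- Short-circuit conjunction. -/
def and (a b : Expr) : Expr := ite a b (const 0)

/-- Negation. -/
def not (a : Expr) : Expr := sub (const 1) a

/-- The test `a < b`. -/
def lt (a b : Expr) : Expr := sub b a

/-- The test `a ≤ b`. -/
def le (a b : Expr) : Expr := sub (add b (const 1)) a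

/-- The test `a = b`. -/
def eq (a b : Expr) : Expr := and (le a b) (le b a)

/-- Bounded existential quantification; the bound variable has index `1` in the body. -/
def ex (n b : Expr) : Expr := fold n (const 0) (ite b (const 1) (var 0))

/-- Bounded universal quantification; the bound variable has index `1` in the body. -/
def all (n b : Expr) : Expr := fold n (const 1) (and b (var 0))

theorem eval_and_ne_zero {a b : Expr} :
    (and a b).eval m l ≠ 0 ↔ a.eval m l ≠ 0 ∧ b.eval m l ≠ 0 := by
  by_cases h : a.eval m l = 0 <;> simp [and, eval, h]

theorem eval_not_ne_zero {a : Expr} : (not a).eval m l ≠ 0 ↔ ¬ a.eval m l ≠ 0 := by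
  simp only [not, eval]; omega

theorem eval_lt_ne_zero {a b : Expr} : (lt a b).eval m l ≠ 0 ↔ a.eval m l < b.eval m l := by
  simp only [lt, eval]; omega

theorem eval_le_ne_zero {a b : Expr} : (le a b).eval m l ≠ 0 ↔ a.eval m l ≤ b.eval m l := by
  simp only [le, eval]; omega

theorem eval_eq_ne_zero {a b : Expr} : (eq a b).eval m l ≠ 0 ↔ a.eval m l = b.eval m l := by
  rw [eq, eval_and_ne_zero, eval_le_ne_zero, eval_le_ne_zero, le_antisymm_iff]

/-- The exact value is needed for the outermost quantifier, whose value is the answer of the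
machine; elsewhere being nonzero is enough. -/
theorem eval_ex {n b : Expr} {p : ℕ → Prop} [DecidablePred p]
    (h : ∀ acc, ∀ i < n.eval m l, b.eval m (acc :: i :: l) ≠ 0 ↔ p i) :
    (ex n b).eval m l = if ∃ i < n.eval m l, p i then 1 else 0 := by
  simp only [ex, eval]
  generalize n.eval m l = k at h ⊢
  induction k with
  | zero => simp [iter]
  | succ k ih =>
    rw [iter, ih fun acc i hi => h acc i (by omega)]
    by_cases hk : p k
    · rw [if_pos ((h _ k (by omega)).2 hk), if_pos ⟨k, by omega, hk⟩]
    · rw [if_neg (mt (h _ k (by omega)).1 hk)]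
      simp only [Nat.exists_lt_succ_right, hk, or_false, List.getD_cons_zero]

theorem eval_ex_ne_zero {n b : Expr} {p : ℕ → Prop}
    (h : ∀ acc, ∀ i < n.eval m l, b.eval m (acc :: i :: l) ≠ 0 ↔ p i) :
    (ex n b).eval m l ≠ 0 ↔ ∃ i < n.eval m l, p i := by
  classical
  rw [eval_ex h]; simp

theorem eval_all_ne_zero {n b : Expr} {p : ℕ → Prop}
    (h : ∀ acc, ∀ i < n.eval m l, b.eval m (acc :: i :: l) ≠ 0 ↔ p i) :
    (all n b).eval m l ≠ 0 ↔ ∀ i < n.eval m l, p i := by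
  simp only [all, eval]
  generalize n.eval m l = k at h ⊢
  induction k with
  | zero => simp [iter]
  | succ k ih =>
    rw [iter, eval_and_ne_zero, h _ k (by omega)]
    simp only [eval, List.getD_cons_zero]
    rw [ih fun acc i hi => h acc i (by omega)]
    rw [Nat.forall_lt_succ_right, and_comm]

theorem cost_ite_le (c a b : Expr) :
    (ite c a b).cost m l ≤ c.cost m l + a.cost m l + b.cost m l + 1 := by
  simp only [cost]; split <;> omega

theorem cost_and_le (a b : Expr) : (and a b).cost m l ≤ a.cost m l + b.cost m l + 2 := by
  have := cost_ite_le (m := m) (l := l) a b (const 0)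
  simp only [cost, and] at this ⊢; omega

theorem cost_not (a : Expr) : (not a).cost m l = a.cost m l + 2 := by
  simp only [cost, not]; omega

theorem cost_lt (a b : Expr) : (lt a b).cost m l = a.cost m l + b.cost m l + 1 := by
  simp only [cost, lt]; omega

theorem cost_le (a b : Expr) : (le a b).cost m l = a.cost m l + b.cost m l + 3 := by
  simp only [cost, le]; omega

theorem cost_eq_le (a b : Expr) : (eq a b).cost m l ≤ 2 * a.cost m l + 2 * b.cost m l + 8 := by
  have := cost_and_le (m := m) (l := l) (le a b) (le b a)
  simp only [cost_le, eq] at this ⊢; omega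

theorem cost_var_le (i : ℕ) : (var i).cost m l ≤ 2 := by
  simp only [cost]; split <;> omega

/-- The body is bounded only at accumulators that actually occur. This matters for `runFactor`,
where the cost of a round grows with the accumulator. -/
theorem cost_fold_le {n a b : Expr} {c : ℕ}
    (h : ∀ i < n.eval m l,
      b.cost m (iter i (fun i acc => b.eval m (acc :: i :: l)) (a.eval m l) :: i :: l) ≤ c) :
    (fold n a b).cost m l ≤ n.cost m l + a.cost m l + n.eval m l * (c + 6) + 5 := by
  simp only [cost]
  have := Finset.sum_le_card_nsmul (Finset.range (n.eval m l)) (fun i => b.cost m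
    (iter i (fun i acc => b.eval m (acc :: i :: l)) (a.eval m l) :: i :: l) + 6) (c + 6)
    fun i hi => Nat.add_le_add_right (h i (Finset.mem_range.1 hi)) 6
  simp only [Finset.card_range, smul_eq_mul] at this
  omega

theorem cost_ex_le {n b : Expr} {c : ℕ}
    (h : ∀ acc, ∀ i < n.eval m l, b.cost m (acc :: i :: l) ≤ c) :
    (ex n b).cost m l ≤ n.cost m l + n.eval m l * (c + 10) + 6 := by
  have := cost_fold_le (m := m) (l := l) (n := n) (a := const 0) (b := ite b (const 1) (var 0))
    (c := c + 4) fun i hi => (cost_ite_le _ _ _).trans (by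
      have := h (iter i (fun i acc => (ite b (const 1) (var 0)).eval m (acc :: i :: l))
        ((const 0).eval m l)) i hi
      simp [cost]; exact this)
  refine this.trans ?_
  simp only [cost, Nat.add_assoc, Nat.reduceAdd]; omega

theorem cost_all_le {n b : Expr} {c : ℕ}
    (h : ∀ acc, ∀ i < n.eval m l, b.cost m (acc :: i :: l) ≤ c) :
    (all n b).cost m l ≤ n.cost m l + n.eval m l * (c + 10) + 6 := by
  have := cost_fold_le (m := m) (l := l) (n := n) (a := const 1) (b := and b (var 0))
    (c := c + 4) fun i hi => (cost_and_le _ _).trans (by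
      have := h (iter i (fun i acc => (and b (var 0)).eval m (acc :: i :: l))
        ((const 1).eval m l)) i hi
      simp [cost]; exact this)
  refine this.trans ?_
  simp only [cost, Nat.add_assoc, Nat.reduceAdd]; omega

/-! ### Access to the input -/

/-- Multiplication with the size of the alphabet. -/
def mulSize (a : Expr) : Expr := fold a (const 0) (add (var 0) (load (const 0)))

/-- The length of the string. -/
def len : Expr := load (const 3)

/-- The address of the description of the first automaton. -/
def descA : Expr := add (const 6) len

/-- The address of the transition table of the first automaton. -/
def tableA : Expr := add descA (load (const 1))

/-- The address of the description of the second automaton. -/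
def descB : Expr := add tableA (mulSize (load (const 1)))

/-- The address of the transition table of the second automaton. -/
def tableB : Expr := add descB (load (const 2))

theorem eval_mulSize (a : Expr) : (mulSize a).eval m l = a.eval m l * m 0 := by
  simp only [mulSize, eval, List.getD_cons_zero]
  induction a.eval m l with
  | zero => simp [iter]
  | succ n ih => rw [iter, ih, Nat.succ_mul]

/-- The number of additions is the value of `a`, so the alphabet size does not enter the running
time. -/
theorem cost_mulSize_le (a : Expr) : (mulSize a).cost m l ≤ a.cost m l + a.eval m l * 11 + 6 := by
  have := cost_fold_le (m := m) (l := l) (n := a) (a := const 0)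
    (b := add (var 0) (load (const 0))) (c := 5) fun i _ => by simp [cost]
  simp only [mulSize]; simp only [cost] at this ⊢; omega

/-- The state (plus one, or `0` if the computation is stuck) that an automaton reaches from `q`
when it reads the factor of length `n` at the position `p`. The environment begins with
`p`, `n`, `q` and the address of the transition table. -/
def runFactor : Expr :=
  fold (var 1) (var 2) (ite (var 0)
    (load (add (var 5) (add (mulSize (sub (var 0) (const 1)))
      (load (add (const 6) (add (var 2) (var 1))))))) (const 0))

/-- One transition of an automaton whose transition table stands at the address `tb`. -/
def nextState (m : ℕ → ℕ) (tb p i q : ℕ) : ℕ :=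
  -- The string starts at address 6, after the header; `q - 1` undoes the shift that reserves `0`
  -- for a stuck run.
  if q = 0 then 0 else m (tb + ((q - 1) * m 0 + m (6 + (p + i))))

theorem eval_runFactor (p n q tb : ℕ) :
    runFactor.eval m (p :: n :: q :: tb :: l) = iter n (nextState m tb p) q := by
  simp [runFactor, eval, eval_mulSize]
  rfl

theorem cost_runFactor_le (p n q tb K : ℕ) (h : ∀ i < n, iter i (nextState m tb p) q ≤ K) :
    runFactor.cost m (p :: n :: q :: tb :: l) ≤ n * (11 * K + 40) + 10 := by
  unfold runFactor
  refine (cost_fold_le (c := 11 * K + 30) ?_).trans ?_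
  · intro i hi
    have hi' := h i (by simpa [eval] using hi)
    have e : iter i (fun i acc => (ite (var 0)
        (load (add (var 5) (add (mulSize (sub (var 0) (const 1)))
          (load (add (const 6) (add (var 2) (var 1))))))) (const 0)).eval m
            (acc :: i :: p :: n :: q :: tb :: l)) ((var 2).eval m (p :: n :: q :: tb :: l)) =
        iter i (nextState m tb p) q := by
      simp [eval, eval_mulSize]
      rfl
    rw [e]
    refine (cost_ite_le _ _ _).trans ?_
    have := cost_mulSize_le (m := m)
      (l := iter i (nextState m tb p) q :: i :: p :: n :: q :: tb :: l) (sub (var 0) (const 1))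
    simp [cost, eval] at this ⊢
    omega
  · simp [cost, eval]
    nlinarith

/-- The test whether the factors of length `n` at the positions `p` and `p + d` agree, in an
environment that begins with `n`, `d` and `p`. -/
def overlap : Expr :=
  all (var 0) (eq (load (add (const 6) (add (var 4) (var 1))))
    (load (add (const 6) (add (add (var 4) (var 3)) (var 1)))))

theorem eval_overlap_ne_zero (n d p : ℕ) :
    overlap.eval m (n :: d :: p :: l) ≠ 0 ↔ ∀ i < n, m (6 + (p + i)) = m (6 + (p + d + i)) := by
  refine (eval_all_ne_zero (p := fun i => m (6 + (p + i)) = m (6 + (p + d + i))) ?_).trans ?_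
  · intro acc i _
    rw [eval_eq_ne_zero]
    simp [eval]
  · simp [eval]

theorem cost_overlap_le (n d p : ℕ) : overlap.cost m (n :: d :: p :: l) ≤ n * 70 + 12 := by
  refine (cost_all_le (c := 60) fun acc i _ => (cost_eq_le _ _).trans ?_).trans ?_
  · simp [cost]
  · simp [cost, eval]
    omega

/-- Whether the state `r` is final in the automaton with the description at the address `a`. -/
def final (a r : Expr) : Expr :=
  bind r (ite (var 0) (load (add a (sub (var 0) (const 1)))) (const 0))

/-- Whether the second automaton accepts the factor between `i` and `l`, in an environment that
begins with `l`, `k`, `j`, `i`. -/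
def acceptsB : Expr :=
  final descB (bind tableB (bind (add (load (const 5)) (const 1))
    (bind (sub (var 2) (var 5)) (bind (var 6) runFactor))))

/-- Whether the first automaton accepts the string without the factor between `j` and `k`, in an
environment that begins with `l`, `k`, `j`, `i`. -/
def acceptsA : Expr :=
  final descA (bind tableA (bind
    (bind (var 0) (bind (add (load (const 4)) (const 1)) (bind (var 5) (bind (const 0) runFactor))))
    (bind (sub len (var 3)) (bind (var 4) runFactor))))

/-- The search for the positions `i`, `j`, `k`, `l`; the remaining condition on them is tested by
`c` in an environment that begins with `l`, `k`, `j`, `i`. -/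
def search (c : Expr) : Expr :=
  ex (add len (const 1)) (ex (add len (const 1)) (ex (add len (const 1)) (ex (add len (const 1))
    (bind (var 7) (bind (var 6) (bind (var 5) (bind (var 4)
      (and (lt (var 3) (var 2)) (and (le (var 2) (var 1)) (and (lt (var 1) (var 0))
        (and acceptsA (and acceptsB c))))))))))))

/-- The condition of maximality. -/
def maximal : Expr :=
  and
    (not (ex (add len (const 1)) (and (lt (const 0) (var 1)) (and (le (var 1) (var 5))
      (and (le (var 1) (sub (var 3) (var 4))) (bind (sub (var 5) (var 1)) (bind (var 2)
        (bind (add (sub (var 6) (var 7)) (var 0)) overlap))))))))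
    (not (ex (add len (const 1)) (and (lt (const 0) (var 1)) (and (le (var 1) (sub len (var 2)))
      (and (le (var 1) (sub (var 3) (var 4))) (bind (sub (var 3) (var 1)) (bind (var 2)
        (bind (add (sub (var 4) (var 5)) (var 0)) overlap))))))))

/-- The condition of minimality. -/
def minimal : Expr :=
  and
    (not (ex (add len (const 1)) (and (lt (const 0) (var 1))
      (and (lt (var 1) (sub (var 4) (var 5))) (bind (var 5) (bind (var 2)
        (bind (sub (sub (var 6) (var 7)) (var 0)) overlap)))))))
    (not (ex (add len (const 1)) (and (lt (const 0) (var 1))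
      (and (lt (var 1) (sub (var 2) (var 3))) (bind (var 3) (bind (var 2)
        (bind (sub (sub (var 4) (var 5)) (var 0)) overlap)))))))

/-! ### Meaning of the two side conditions -/

theorem eval_maximal_ne_zero (i j k l : ℕ) (r : List ℕ) :
    maximal.eval m (l :: k :: j :: i :: r) ≠ 0 ↔
      (¬ ∃ d < m 3 + 1, 0 < d ∧ d ≤ i ∧ d ≤ k - j ∧
        ∀ x < j - i + d, m (6 + (i - d + x)) = m (6 + (i - d + d + x))) ∧
      (¬ ∃ d < m 3 + 1, 0 < d ∧ d ≤ m 3 - l ∧ d ≤ k - j ∧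
        ∀ x < l - k + d, m (6 + (k - d + x)) = m (6 + (k - d + d + x))) := by
  rw [maximal, eval_and_ne_zero, eval_not_ne_zero, eval_not_ne_zero]
  refine and_congr (not_congr ?_) (not_congr ?_)
  · refine eval_ex_ne_zero fun acc d _ => ?_
    simp only [eval_and_ne_zero, eval_lt_ne_zero, eval_le_ne_zero]
    simp only [eval, List.getD_cons_zero, List.getD_cons_succ]
    rw [eval_overlap_ne_zero]
  · refine eval_ex_ne_zero fun acc d _ => ?_
    simp only [eval_and_ne_zero, eval_lt_ne_zero, eval_le_ne_zero]
    simp only [eval, List.getD_cons_zero, List.getD_cons_succ, len]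
    rw [eval_overlap_ne_zero]

theorem eval_minimal_ne_zero (i j k l : ℕ) (r : List ℕ) :
    minimal.eval m (l :: k :: j :: i :: r) ≠ 0 ↔
      (¬ ∃ d < m 3 + 1, 0 < d ∧ d < j - i ∧
        ∀ x < j - i - d, m (6 + (i + x)) = m (6 + (i + d + x))) ∧
      (¬ ∃ d < m 3 + 1, 0 < d ∧ d < l - k ∧
        ∀ x < l - k - d, m (6 + (k + x)) = m (6 + (k + d + x))) := by
  rw [minimal, eval_and_ne_zero, eval_not_ne_zero, eval_not_ne_zero]
  refine and_congr (not_congr ?_) (not_congr ?_)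
  · refine eval_ex_ne_zero fun acc d _ => ?_
    simp only [eval_and_ne_zero, eval_lt_ne_zero]
    simp only [eval, List.getD_cons_zero, List.getD_cons_succ]
    rw [eval_overlap_ne_zero]
  · refine eval_ex_ne_zero fun acc d _ => ?_
    simp only [eval_and_ne_zero, eval_lt_ne_zero]
    simp only [eval, List.getD_cons_zero, List.getD_cons_succ]
    rw [eval_overlap_ne_zero]

end Expr

end RAM

end SDI

namespace SDI

/-! ### Automata and their descriptions -/

namespace PDFA

variable {s k : ℕ}

theorem run_append (M : PDFA s k) (q : Fin k) (u v : List (Fin s)) :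
    M.run q (u ++ v) = (M.run q u).bind fun q' => M.run q' v := by
  induction u generalizing q with
  | nil => rfl
  | cons a u ih =>
    simp only [List.cons_append, run]
    cases M.step q a with
    | none => rfl
    | some q' => exact ih q'

theorem run_singleton (M : PDFA s k) (q : Fin k) (a : Fin s) : M.run q [a] = M.step q a := by
  simp only [run]; cases M.step q a <;> rfl

/-- States are stored as positive numbers; `0` stands for a stuck computation. -/
def code : Option (Fin k) → ℕ
  | none => 0
  | some q => (q : ℕ) + 1

theorem code_le (o : Option (Fin k)) : code o ≤ k := by
  cases o with
  | none => exact Nat.zero_le _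
  | some q => exact q.2

theorem entry_eq_code (M : PDFA s k) (q : Fin k) (a : Fin s) : M.entry q a = code (M.step q a) := by
  unfold entry; cases M.step q a <;> rfl

/-- The memory `m` contains the description of `M` at the address `a`. -/
structure IsStoredAt (M : PDFA s k) (m : ℕ → ℕ) (a : ℕ) : Prop where
  accept (q : Fin k) : m (a + q) = if M.accept q then 1 else 0
  entry (q : Fin k) (x : Fin s) : m (a + k + (q * s + x)) = M.entry q x

/-- All rows have length `s`; removing the first row lowers `q` by one and the offset by `s`. -/
theorem getD_flatMap_finRange (f : Fin k → List ℕ) (hf : ∀ q, (f q).length = s) (q : Fin k) {x : ℕ}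
    (hx : x < s) : ((List.finRange k).flatMap f).getD (q * s + x) 0 = (f q).getD x 0 := by
  induction k with
  | zero => exact q.elim0
  | succ k ih =>
    rw [List.finRange_succ, List.flatMap_cons, List.flatMap_map]
    refine Fin.cases ?_ (fun q => ?_) q
    · rw [List.getD_append _ _ _ _ (by simp [hf, hx])]; simp
    · rw [List.getD_append_right _ _ _ _ (by simp [hf, Nat.succ_mul]; omega), ← ih _ fun q => hf _]
      congr 1
      simp [hf, Nat.succ_mul]; omega

theorem length_encode (M : PDFA s k) : M.encode.length = k + k * s := by
  simp [encode]

theorem isStoredAt_encode (M : PDFA s k) (u v : List ℕ) :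
    M.IsStoredAt (fun i => (u ++ M.encode ++ v).getD i 0) u.length where
  accept q := by
    simp only [encode, List.append_assoc]
    rw [List.getD_append_right _ _ _ _ (by omega), List.getD_append _ _ _ _ (by simp)]
    simp
  entry q x := by
    have h : (q : ℕ) * s + x < k * s :=
      calc (q : ℕ) * s + x < q * s + s := by omega
        _ = (q + 1) * s := by ring
        _ ≤ k * s := Nat.mul_le_mul_right _ q.2
    simp only [encode, List.append_assoc]
    rw [List.getD_append_right _ _ _ _ (by omega), List.getD_append_right _ _ _ _ (by simp; omega),
      List.getD_append _ _ _ _ (by simp; omega)]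
    simp only [List.length_map, List.length_finRange]
    rw [show u.length + k + (q * s + x) - u.length - k = q * s + x by omega,
      getD_flatMap_finRange _ (by simp) q x.2]
    simp

end PDFA

namespace RAM

open PDFA

/-- The memory `m` contains the input of the membership problem. -/
structure IsInput {s kA kB : ℕ} (A : PDFA s kA) (B : PDFA s kB) (w : List (Fin s))
    (m : ℕ → ℕ) : Prop where
  size : m 0 = s
  statesA : m 1 = kA
  statesB : m 2 = kB
  len : m 3 = w.length
  startA : m 4 = A.start
  startB : m 5 = B.start
  word (i : ℕ) (h : i < w.length) : m (6 + i) = w[i]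
  descA : A.IsStoredAt m (6 + w.length)
  descB : B.IsStoredAt m (6 + w.length + kA + kA * s)

theorem encodeInput_eq {s kA kB : ℕ} (A : PDFA s kA) (B : PDFA s kB) (w : List (Fin s)) :
    encodeInput A B w = [s, kA, kB, w.length, (A.start : ℕ), (B.start : ℕ)] ++ w.map Fin.val ++
      A.encode ++ B.encode := by
  simp [encodeInput, List.map_eq_flatMap]

theorem isInput_encodeInput {s kA kB : ℕ} (A : PDFA s kA) (B : PDFA s kB) (w : List (Fin s)) :
    IsInput A B w fun i => (encodeInput A B w).getD i 0 where
  size := rfl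
  statesA := rfl
  statesB := rfl
  len := rfl
  startA := rfl
  startB := rfl
  word i h := by
    simp only [encodeInput_eq, List.append_assoc]
    rw [List.getD_append_right _ _ _ _ (by simp),
      show 6 + i - [s, kA, kB, w.length, (A.start : ℕ), (B.start : ℕ)].length = i by simp,
      List.getD_append _ _ _ _ (by rwa [List.length_map]),
      List.getD_eq_getElem _ _ (by rwa [List.length_map]), List.getElem_map]
  descA := by
    have e := A.isStoredAt_encode ([s, kA, kB, w.length, (A.start : ℕ), (B.start : ℕ)] ++
      w.map Fin.val) B.encode
    rw [List.length_append, List.length_map, ← encodeInput_eq] at e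
    exact e
  descB := by
    have e := B.isStoredAt_encode ([s, kA, kB, w.length, (A.start : ℕ), (B.start : ℕ)] ++
      w.map Fin.val ++ A.encode) []
    rw [List.length_append, List.length_append, List.length_map, length_encode, ← Nat.add_assoc,
      List.append_nil, ← encodeInput_eq] at e
    exact e

/-! ### Correctness of the search -/

namespace Expr

variable {s k kA kB : ℕ} {A : PDFA s kA} {B : PDFA s kB} {M : PDFA s k} {w : List (Fin s)}
  {m : ℕ → ℕ}

theorem nextState_code (hs : m 0 = s) (hw : ∀ i (h : i < w.length), m (6 + i) = w[i]) {a : ℕ}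
    (hM : M.IsStoredAt m a) {p i : ℕ} (h : p + i < w.length) (o : Option (Fin k)) :
    nextState m (a + k) p i (code o) = code (o.bind fun q => M.step q w[p + i]) := by
  cases o with
  | none => rfl
  | some q => simp [nextState, code, hs, hw _ h, hM.entry, entry_eq_code]

/-- Allowing a possibly stuck start `o` lets two runs be chained, as `acceptsA` requires when it
skips the middle block. -/
theorem iter_nextState (hs : m 0 = s) (hw : ∀ i (h : i < w.length), m (6 + i) = w[i]) {a : ℕ}
    (hM : M.IsStoredAt m a) {p n : ℕ} (h : p + n ≤ w.length) (o : Option (Fin k)) :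
    iter n (nextState m (a + k) p) (code o) = code (o.bind fun q => M.run q (factor w p n)) := by
  induction n with
  | zero => cases o <;> simp [iter, factor, run]
  | succ n ih =>
    have e : factor w p (n + 1) = factor w p n ++ [w[p + n]] := by
      rw [factor_add]
      congr 1
      rw [factor, List.drop_eq_getElem_cons (by omega), List.take_succ_cons, List.take_zero]
    rw [iter, ih (by omega), nextState_code hs hw hM (by omega), e, Option.bind_assoc]
    simp only [run_append, run_singleton]

theorem eval_final_ne_zero {a r : Expr} {l : List ℕ} {b : ℕ} (ha : ∀ l, a.eval m l = b)
    (hM : M.IsStoredAt m b) {o : Option (Fin k)} (hr : r.eval m l = code o) :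
    (final a r).eval m l ≠ 0 ↔ ∃ q, o = some q ∧ M.accept q = true := by
  simp only [final, eval, hr, List.getD_cons_zero, ha]
  cases o with
  | none => simp [code]
  | some q => simp [code, hM.accept]

theorem eval_descA (h : IsInput A B w m) (l : List ℕ) : descA.eval m l = 6 + w.length := by
  simp [descA, len, eval, h.len]

theorem eval_tableA (h : IsInput A B w m) (l : List ℕ) :
    tableA.eval m l = 6 + w.length + kA := by
  simp [tableA, eval, eval_descA h, h.statesA]

theorem eval_descB (h : IsInput A B w m) (l : List ℕ) :
    descB.eval m l = 6 + w.length + kA + kA * s := by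
  simp [descB, eval, eval_tableA h, eval_mulSize, h.statesA, h.size]

theorem eval_tableB (h : IsInput A B w m) (l : List ℕ) :
    tableB.eval m l = 6 + w.length + kA + kA * s + kB := by
  simp [tableB, eval, eval_descB h, h.statesB]

theorem eval_acceptsA_ne_zero (h : IsInput A B w m) {i j k l : ℕ} (r : List ℕ)
    (hj : j ≤ w.length) (hk : k ≤ w.length) :
    acceptsA.eval m (l :: k :: j :: i :: r) ≠ 0 ↔
      factor w 0 j ++ factor w k (w.length - k) ∈ A.language := by
  refine eval_final_ne_zero (o := A.run A.start (factor w 0 j ++ factor w k (w.length - k)))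
    (eval_descA h) h.descA ?_
  have e : (A.start : ℕ) + 1 = code (some A.start) := rfl
  simp only [eval, List.getD_cons_zero, List.getD_cons_succ, eval_runFactor, eval_tableA h, h.startA,
    e, len, h.len]
  rw [iter_nextState h.size h.word h.descA (by omega), iter_nextState h.size h.word h.descA (by omega),
    run_append]
  rfl

theorem eval_acceptsB_ne_zero (h : IsInput A B w m) {i j k l : ℕ} (r : List ℕ)
    (hi : i ≤ l) (hl : l ≤ w.length) :
    acceptsB.eval m (l :: k :: j :: i :: r) ≠ 0 ↔ factor w i (l - i) ∈ B.language := by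
  refine eval_final_ne_zero (o := B.run B.start (factor w i (l - i))) (eval_descB h) h.descB ?_
  have e : (B.start : ℕ) + 1 = code (some B.start) := rfl
  simp only [eval, List.getD_cons_zero, List.getD_cons_succ, eval_runFactor, eval_tableB h, h.startB,
    e]
  rw [iter_nextState h.size h.word h.descB (by omega)]
  rfl

theorem overlap_iff (h : IsInput A B w m) {p d n : ℕ} (hn : p + d + n ≤ w.length) :
    (∀ x < n, m (6 + (p + x)) = m (6 + (p + d + x))) ↔ Overlap w p d n := by
  simp only [Overlap, List.ext_getElem_iff, length_factor (w := w) (p := p) (n := n) (by omega),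
    length_factor (w := w) (p := p + d) (n := n) hn, true_and]
  refine forall_congr' fun x => ⟨fun hx h1 _ => ?_, fun hx h1 => ?_⟩
  · have := hx h1
    rw [h.word _ (by omega), h.word _ (by omega)] at this
    simpa [factor] using Fin.ext this
  · have := hx h1 h1
    simp only [factor, List.getElem_take, List.getElem_drop] at this
    rw [h.word _ (by omega), h.word _ (by omega), this]

theorem eval_search (h : IsInput A B w m) {c : Expr} {p : Prop} (q : ℕ → ℕ → ℕ → ℕ → Prop)
    (hp : p ↔ ∃ i j k l, Cut A.language B.language w i j k l ∧ q i j k l)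
    (hc : ∀ i j k l, i < j → j ≤ k → k < l → l ≤ w.length → ∀ r,
      c.eval m (l :: k :: j :: i :: r) ≠ 0 ↔ q i j k l) :
    (p → (search c).eval m [] = 1) ∧ (¬ p → (search c).eval m [] = 0) := by
  classical
  have hlen : ∀ l, (add len (const 1)).eval m l = w.length + 1 := fun l => by
    simp [len, eval, h.len]
  have key : ∀ {b : Expr} {l : List ℕ} {p : ℕ → Prop},
      (∀ acc, ∀ i < w.length + 1, b.eval m (acc :: i :: l) ≠ 0 ↔ p i) →
      ((ex (add len (const 1)) b).eval m l ≠ 0 ↔ ∃ i < w.length + 1, p i) := by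
    intro b l p hb
    rw [← hlen l] at hb ⊢
    exact eval_ex_ne_zero hb
  have e : (search c).eval m [] = if ∃ i < w.length + 1, ∃ j < w.length + 1, ∃ k < w.length + 1,
      ∃ l < w.length + 1, Cut A.language B.language w i j k l ∧ q i j k l then 1 else 0 := by
    rw [search, ← hlen []]
    refine eval_ex fun a i hi => ?_
    rw [hlen] at hi ⊢
    refine key fun a' j hj => key fun a'' k hk => key fun a''' l hl => ?_
    simp only [eval, List.getD_cons_zero, List.getD_cons_succ, eval_and_ne_zero, eval_lt_ne_zero,
      eval_le_ne_zero]
    -- The order tests come first, so acceptance and `c` need to be correct only for ordered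
    -- positions.
    rw [Cut, and_assoc, and_assoc, and_assoc, and_assoc, and_assoc]
    refine and_congr_right fun h1 => and_congr_right fun h2 => and_congr_right fun h3 => ?_
    rw [and_iff_right (show l ≤ w.length by omega), eval_acceptsA_ne_zero h _ (by omega) (by omega),
      eval_acceptsB_ne_zero h _ (by omega) (by omega), hc i j k l h1 h2 h3 (by omega)]
  have e' : p ↔ ∃ i < w.length + 1, ∃ j < w.length + 1, ∃ k < w.length + 1,
      ∃ l < w.length + 1, Cut A.language B.language w i j k l ∧ q i j k l := by
    rw [hp]
    constructor
    · rintro ⟨i, j, k, l, hc, hq⟩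
      have ⟨h1, h2, h3, h4, _⟩ := hc
      exact ⟨i, by omega, j, by omega, k, by omega, l, by omega, hc, hq⟩
    · rintro ⟨i, -, j, -, k, -, l, -, hc⟩
      exact ⟨i, j, k, l, hc⟩
  rw [e, e']
  exact ⟨fun h => if_pos h, fun h => if_neg h⟩

/-- The search range for `d` loses nothing, because `d ≤ i` or `d ≤ |w| - l`. The bounds on `d` also
keep both compared factors inside `w`. -/
theorem eval_search_maximal (h : IsInput A B w m) :
    (w ∈ maxSDI A.language B.language → (search maximal).eval m [] = 1) ∧
      (w ∉ maxSDI A.language B.language → (search maximal).eval m [] = 0) := by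
  refine eval_search h _ (mem_maxSDI_iff _ _ w) fun i j k l h1 h2 h3 h4 r => ?_
  rw [eval_maximal_ne_zero, h.len]
  refine and_congr (not_congr (exists_congr fun d => ?_)) (not_congr (exists_congr fun d => ?_))
  · constructor
    · rintro ⟨-, h₁, h₂, h₃, h₄⟩
      exact ⟨h₁, h₂, h₃, (overlap_iff h (by omega)).1 h₄⟩
    · rintro ⟨h₁, h₂, h₃, h₄⟩
      exact ⟨by omega, h₁, h₂, h₃, (overlap_iff h (by omega)).2 h₄⟩
  · constructor
    · rintro ⟨-, h₁, h₂, h₃, h₄⟩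
      exact ⟨h₁, h₂, h₃, (overlap_iff h (by omega)).1 h₄⟩
    · rintro ⟨h₁, h₂, h₃, h₄⟩
      exact ⟨by omega, h₁, h₂, h₃, (overlap_iff h (by omega)).2 h₄⟩

theorem eval_search_minimal (h : IsInput A B w m) :
    (w ∈ minSDI A.language B.language → (search minimal).eval m [] = 1) ∧
      (w ∉ minSDI A.language B.language → (search minimal).eval m [] = 0) := by
  refine eval_search h _ (mem_minSDI_iff _ _ w) fun i j k l h1 h2 h3 h4 r => ?_
  rw [eval_minimal_ne_zero, h.len]
  refine and_congr (not_congr (exists_congr fun d => ?_)) (not_congr (exists_congr fun d => ?_))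
  · constructor
    · rintro ⟨-, h₁, h₂, h₄⟩
      exact ⟨h₁, h₂, (overlap_iff h (by omega)).1 h₄⟩
    · rintro ⟨h₁, h₂, h₄⟩
      exact ⟨by omega, h₁, h₂, (overlap_iff h (by omega)).2 h₄⟩
  · constructor
    · rintro ⟨-, h₁, h₂, h₄⟩
      exact ⟨h₁, h₂, (overlap_iff h (by omega)).1 h₄⟩
    · rintro ⟨h₁, h₂, h₄⟩
      exact ⟨by omega, h₁, h₂, (overlap_iff h (by omega)).2 h₄⟩

end Expr

end RAM

end SDI

namespace SDI

namespace RAM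

open PDFA

namespace Expr

variable {s k kA kB : ℕ} {A : PDFA s kA} {B : PDFA s kB} {M : PDFA s k} {w : List (Fin s)}
  {m : ℕ → ℕ}

/-! ### Running time -/

/-- Every state reached has a code at most `k ≤ N`, so each of at most `N` letters costs `O(N)`; `61
= 11 + 40 + 10`. -/
theorem cost_runFactor_code_le (hs : m 0 = s) (hw : ∀ i (h : i < w.length), m (6 + i) = w[i])
    {a : ℕ} (hM : M.IsStoredAt m a) {p n N : ℕ} (h : p + n ≤ w.length) (hw' : w.length ≤ N)
    (hk : k ≤ N) (hN : 1 ≤ N) (o : Option (Fin k)) (l : List ℕ) :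
    runFactor.cost m (p :: n :: code o :: (a + k) :: l) ≤ 61 * N ^ 2 := by
  refine (cost_runFactor_le p n (code o) (a + k) N fun i hi => ?_).trans ?_
  · rw [iter_nextState hs hw hM (by omega)]
    exact (code_le _).trans hk
  · have h1 : n * (11 * N + 40) ≤ N * (11 * N + 40) := Nat.mul_le_mul_right _ (by omega)
    nlinarith

theorem cost_tableB_le (h : IsInput A B w m) (l : List ℕ) :
    tableB.cost m l ≤ 11 * kA + 20 ∧ descB.cost m l ≤ 11 * kA + 20 := by
  have := cost_mulSize_le (m := m) (l := l) (load (const 1))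
  simp only [tableB, descB, tableA, descA, len, cost, eval, h.statesA] at this ⊢
  omega

theorem cost_final_le (a r : Expr) (l : List ℕ) (c : ℕ) (hc : ∀ l, a.cost m l ≤ c) :
    (final a r).cost m l ≤ r.cost m l + c + 20 := by
  simp only [final]
  have h1 := hc (r.eval m l :: l)
  have h2 := cost_ite_le (m := m) (l := r.eval m l :: l) (var 0)
    (load (add a (sub (var 0) (const 1)))) (const 0)
  have h3 := cost_var_le (m := m) (l := r.eval m l :: l) 0
  rw [cost]
  simp only [cost.eq_1, cost.eq_3, cost.eq_4, cost.eq_5] at h2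
  omega

theorem cost_acceptsA_le (h : IsInput A B w m) {i j k l N : ℕ} (r : List ℕ)
    (hj : j ≤ w.length) (hk : k ≤ w.length) (hw : w.length ≤ N) (hA : kA ≤ N) (hN : 1 ≤ N) :
    acceptsA.cost m (l :: k :: j :: i :: r) ≤ 250 * N ^ 2 := by
  have e : (A.start : ℕ) + 1 = code (some A.start) := rfl
  refine (cost_final_le _ _ _ 4 fun l => by simp [descA, len, cost]).trans ?_
  have hl : ∀ l, tableA.cost m l = 7 := fun l => by simp [tableA, descA, len, cost]
  have h1 := cost_runFactor_code_le h.size h.word h.descA (p := 0) (n := j) (by omega) hw hA hN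
    (some A.start)
  have h2 := cost_runFactor_code_le h.size h.word h.descA (p := k) (n := w.length - k) (by omega)
    hw hA hN (A.run A.start (factor w 0 j))
  simp only [cost, eval, List.getD_cons_zero, List.getD_cons_succ, eval_runFactor, eval_tableA h,
    h.startA, e, len, h.len, hl]
  rw [iter_nextState h.size h.word h.descA (by omega)]
  simp only [Option.bind_some]
  have hN' : 1 ≤ N ^ 2 := Nat.one_le_pow _ _ hN
  grw [h1, h2]
  simp
  omega

theorem cost_acceptsB_le (h : IsInput A B w m) {i j k l N : ℕ} (r : List ℕ)
    (hi : i ≤ w.length) (hl : l ≤ w.length) (hw : w.length ≤ N) (hA : kA ≤ N) (hB : kB ≤ N)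
    (hN : 1 ≤ N) : acceptsB.cost m (l :: k :: j :: i :: r) ≤ 250 * N ^ 2 := by
  have e : (B.start : ℕ) + 1 = code (some B.start) := rfl
  refine (cost_final_le _ _ _ _ fun l => (cost_tableB_le h l).2).trans ?_
  have h1 := cost_runFactor_code_le h.size h.word h.descB (p := i) (n := l - i) (by omega) hw hB hN
    (some B.start)
  have h2 := (cost_tableB_le h (l :: k :: j :: i :: r)).1
  simp only [cost, eval, List.getD_cons_zero, List.getD_cons_succ, eval_tableB h, h.startB, e]
  have hN' : 1 ≤ N ^ 2 := Nat.one_le_pow _ _ hN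
  have hN'' : N ≤ N ^ 2 := Nat.le_self_pow (by omega) _
  grw [h1, h2]
  simp
  omega

/-- A quantifier over positions raises the exponent by one; its overhead is absorbed by adding 20 to
the constant. -/
theorem cost_ex_len_le (h : IsInput A B w m) {b : Expr} {l : List ℕ} {N K e : ℕ}
    (hw : w.length + 1 ≤ N) (hb : ∀ acc, ∀ i ≤ w.length, b.cost m (acc :: i :: l) ≤ K * N ^ e) :
    (ex (add len (const 1)) b).cost m l ≤ (K + 20) * N ^ (e + 1) := by
  have hlen : (add len (const 1)).eval m l = w.length + 1 := by simp [len, eval, h.len]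
  refine (cost_ex_le (c := K * N ^ e) fun acc i hi => hb acc i (by omega)).trans ?_
  rw [hlen]
  have h1 : (w.length + 1) * (K * N ^ e + 10) ≤ N * (K * N ^ e + 10) := Nat.mul_le_mul_right _ hw
  have h2 : 1 ≤ N ^ e := Nat.one_le_pow _ _ (by omega)
  have h3 : N ≤ N ^ e * N := Nat.le_mul_of_pos_left _ h2
  have h4 : N * (K * N ^ e + 10) = K * (N ^ e * N) + 10 * N := by ring
  have h5 : (K + 20) * N ^ (e + 1) = K * (N ^ e * N) + 20 * (N ^ e * N) := by ring
  simp only [cost, len]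
  omega

theorem cost_maximal_le (h : IsInput A B w m) {i j k l N : ℕ} (r : List ℕ)
    (hj : j ≤ w.length) (hl : l ≤ w.length) (hw : w.length + 1 ≤ N) :
    maximal.cost m (l :: k :: j :: i :: r) ≤ 700 * N ^ 2 := by
  have hN' : N ≤ N ^ 2 := Nat.le_self_pow (by omega) _
  unfold maximal
  grw [cost_and_le]
  rw [cost_not, cost_not]
  grw [cost_ex_len_le h hw (K := 300) (e := 1), cost_ex_len_le h hw (K := 300) (e := 1)]
  · simp only [Nat.reduceAdd]; omega
  all_goals
    intro acc d hd
    grw [cost_and_le, cost_and_le, cost_and_le]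
    simp only [cost, eval, cost_lt, cost_le, List.getD_cons_zero, List.getD_cons_succ]
    grw [cost_overlap_le]
    simp [len, cost]
    omega

theorem cost_minimal_le (h : IsInput A B w m) {i j k l N : ℕ} (r : List ℕ)
    (hj : j ≤ w.length) (hl : l ≤ w.length) (hw : w.length + 1 ≤ N) :
    minimal.cost m (l :: k :: j :: i :: r) ≤ 700 * N ^ 2 := by
  have hN' : N ≤ N ^ 2 := Nat.le_self_pow (by omega) _
  unfold minimal
  grw [cost_and_le]
  rw [cost_not, cost_not]
  grw [cost_ex_len_le h hw (K := 300) (e := 1), cost_ex_len_le h hw (K := 300) (e := 1)]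
  · simp only [Nat.reduceAdd]; omega
  all_goals
    intro acc d hd
    grw [cost_and_le, cost_and_le]
    simp only [cost, eval, cost_lt, List.getD_cons_zero, List.getD_cons_succ]
    grw [cost_overlap_le]
    simp
    omega

theorem cost_search_le (h : IsInput A B w m) {c : Expr}
    (hc : ∀ i j k l N, j ≤ w.length → l ≤ w.length → w.length + 1 ≤ N → ∀ r,
      c.cost m (l :: k :: j :: i :: r) ≤ 700 * N ^ 2) :
    (search c).cost m [] ≤ 1400 * (w.length + kA + kB) ^ 6 := by
  -- An automaton has an initial state, hence at least one state; this yields `|w| + 1 ≤ N`, the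
  -- number of rounds of a quantifier.
  have hA : 1 ≤ kA := A.start.pos
  have hB : 1 ≤ kB := B.start.pos
  set N := w.length + kA + kB with hN
  have hN' : 1 ≤ N ^ 2 := Nat.one_le_pow _ _ (by omega)
  have hw : w.length + 1 ≤ N := by omega
  -- The innermost body costs at most `250 + 250 + 700` times `N ^ 2` plus a constant, hence `1300 *
  -- N ^ 2`; four quantifiers add 20 each and lift the exponent to 6.
  refine (cost_ex_len_le h hw (K := 1360) (e := 5) fun a i hi => ?_).trans
    (Nat.mul_le_mul_right _ (by omega))
  refine (cost_ex_len_le h hw (K := 1340) (e := 4) fun a' j hj => ?_)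
  refine (cost_ex_len_le h hw (K := 1320) (e := 3) fun a'' k hk => ?_)
  refine (cost_ex_len_le h hw (K := 1300) (e := 2) fun a''' l hl => ?_)
  simp only [cost, eval, List.getD_cons_zero, List.getD_cons_succ]
  grw [cost_and_le, cost_and_le, cost_and_le, cost_and_le, cost_and_le,
    cost_acceptsA_le h _ hj hk (by omega : w.length ≤ N) (by omega) (by omega),
    cost_acceptsB_le h _ hi hl (by omega : w.length ≤ N) (by omega) (by omega) (by omega),
    hc i j k l N hj hl hw]
  simp [cost_lt, cost_le, cost]
  omega

end Expr

end RAM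

end SDI

/-! ### The two decision procedures -/

open SDI RAM Expr in
theorem lemma3 :
    (∃ (P : SDI.RAM.Prog) (C : ℕ),
      ∀ (s kA kB : ℕ) (A : SDI.PDFA s kA) (B : SDI.PDFA s kB) (w : List (Fin s)),
        P.DecidesWithin (SDI.encodeInput A B w)
          (w ∈ SDI.maxSDI A.language B.language)
          (C * (w.length + kA + kB) ^ 6)) ∧
    (∃ (P : SDI.RAM.Prog) (C : ℕ),
      ∀ (s kA kB : ℕ) (A : SDI.PDFA s kA) (B : SDI.PDFA s kB) (w : List (Fin s)),
        P.DecidesWithin (SDI.encodeInput A B w)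
          (w ∈ SDI.minSDI A.language B.language)
          (C * (w.length + kA + kB) ^ 6)) := by
  refine ⟨⟨(search maximal).compile [] 0, 1400, fun s kA kB A B w => ?_⟩,
    ⟨(search minimal).compile [] 0, 1400, fun s kA kB A B w => ?_⟩⟩
  · have h := isInput_encodeInput A B w
    exact decidesWithin_compile _ _ _ _
      (cost_search_le h fun _ _ _ _ _ hj hl hN r => cost_maximal_le h r hj hl hN)
      (eval_search_maximal h).1 (eval_search_maximal h).2
  · have h := isInput_encodeInput A B w
    exact decidesWithin_compile _ _ _ _
      (cost_search_le h fun _ _ _ _ _ hj hl hN r => cost_minimal_le h r hj hl hN)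
      (eval_search_minimal h).1 (eval_search_minimal h).2
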